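/- Consider the Cramér–Lundberg model with premium rate $p$, claim intensity $\beta>0$, discount rate $q>0$ and maximal dividend rate $\overline c$. The free surplus is $$X_t=x+pt-\sum_{i=1}^{N_t}U_i ,\qquad t\ge 0,$$ where $(N_t)$ is a Poisson process with intensity $\beta$ (that is, the interarrival times of the claims are i.i.d. exponential with parameter $\beta$), independent of the claim sizes $U_i\ge 0$, which are i.i.d. with finite mean, with distribution function $F$, and satisfy the safety loading condition $p>\beta\,\mathbb E[U_i]$. Assume that $F$ is globally Lipschitz: there is $K>0$ with $0\le F(y)-F(x)\le K(y-x)$ for all $x<y$. Let $(\mathcal F_t)_{t\ge0}$ be the filtration generated by $(X_t)$, completed by the null sets. For $x\ge 0$ and $c\in[0,\overline c]$ let $\Pi_{x,c,\overline c}$ be the set of admissible dividend ratcheting strategies, i.e. of all processes $C=(C_t)_{t\ge 0}$ that are $(\mathcal F_t)$-adapted, càdlàg, non-decreasing and satisfy $c\le C_t\le\overline c$ for all $t\ge 0$. Put $X^C_t=X_t-\int_0^tC_s\,ds$, let $\tau=\inf\{t\ge 0: X^C_t<0\}$ be the ruin time, and set $$J(x;C)=\mathbb E\Big[\int_0^{\tau}e^{-qs}C_s\,ds\Big],\qquad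 V(x,c)=\sup_{C\in\Pi_{x,c,\overline c}}J(x;C).$$ **Proposition.** If $\overline c>p$, then there exist constants $K_2>0$ and $K_3>0$ (depending only on $p,\beta,q,\overline c$ and $F$) such that $$0\le V(x_2,c_1)-V(x_1,c_2)\le\Big[K_2+\frac{K_3}{c_1-p}\Big](x_2-x_1)+\Big[K_2+\frac{K_3\,x_2}{(c_1-p)^2}\Big](c_2-c_1)$$ for all $0\le x_1\le x_2$ and $p<c_1\le c_2\le\overline c$. -/

import Mathlib

open MeasureTheory ProbabilityTheory Filter Topology Set

namespace Ratcheting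

noncomputable section

/-- The arrival time of the `n`-th claim (claims are numbered from `0`), as the sum of the first
`n + 1` interarrival times. -/
def arrivalTime {Ω : Type*} (W : ℕ → Ω → ℝ) (n : ℕ) (ω : Ω) : ℝ :=
  ∑ k ∈ Finset.range (n + 1), W k ω

/-- The number `N_t` of claims that have arrived up to time `t`. -/
def claimCount {Ω : Type*} (W : ℕ → Ω → ℝ) (t : ℝ) (ω : Ω) : ℕ :=
  Set.ncard {n : ℕ | arrivalTime W n ω ≤ t}

/-- The free surplus `X_t = x + p t - ∑_{i ≤ N_t} U_i`. -/
def surplus {Ω : Type*} (x p : ℝ) (W U : ℕ → Ω → ℝ) (t : ℝ) (ω : Ω) : ℝ :=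
  x + p * t - ∑ i ∈ Finset.range (claimCount W t ω), U i ω

/-- The probabilistic assumptions of the Cramér-Lundberg model with claim intensity `β` and claim
size law `ν`: the claim sizes `U` are i.i.d. with law `ν`, the interarrival times `W` are i.i.d.
exponential with parameter `β` (so that the claim counting process is a Poisson process with
intensity `β`), and the two families are independent of each other. -/
structure IsCramerLundberg {Ω : Type*} [MeasurableSpace Ω] (μ : Measure Ω) (β : ℝ)
    (ν : Measure ℝ) (W U : ℕ → Ω → ℝ) : Prop where
  measurable_interarrival : ∀ n, Measurable (W n)
  measurable_claim : ∀ n, Measurable (U n)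
  map_interarrival : ∀ n, μ.map (W n) = expMeasure β
  map_claim : ∀ n, μ.map (U n) = ν
  indep : iIndepFun (fun i : ℕ ⊕ ℕ => Sum.elim W U i) μ

/-- The filtration generated by the free surplus process, completed by the null sets: an event
belongs to the `σ`-algebra at time `t` if it agrees up to a null set with an event that is
generated by `(X_s)_{0 ≤ s ≤ t}`. -/
def surplusFiltration {Ω : Type*} [m : MeasurableSpace Ω] (μ : Measure Ω) (x p : ℝ)
    (W U : ℕ → Ω → ℝ) : Filtration ℝ m where
  seq t := eventuallyMeasurableSpace
    (⨆ s ∈ Set.Icc (0 : ℝ) t, MeasurableSpace.comap (surplus x p W U s) inferInstance) (ae μ) ⊓ m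
  mono' := by
    intro s t hst
    refine inf_le_inf_right m ?_
    rintro A ⟨B, hB, hAB⟩
    refine ⟨B, ?_, hAB⟩
    exact (biSup_mono fun r hr => Set.Icc_subset_Icc_right hst hr :
      (⨆ r ∈ Set.Icc (0 : ℝ) s, MeasurableSpace.comap (surplus x p W U r) inferInstance) ≤
        ⨆ r ∈ Set.Icc (0 : ℝ) t, MeasurableSpace.comap (surplus x p W U r) inferInstance) B hB
  le' _ := inf_le_right

/-- The set `Π_{x,c,cbar}` of admissible dividend ratcheting strategies. A strategy is a process
`C` of which only the values at times `t ≥ 0` matter: it is adapted, càdlàg, non-decreasing, and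
takes values in `[c, cbar]`. -/
structure IsAdmissible {Ω : Type*} [MeasurableSpace Ω] (μ : Measure Ω) (p cbar : ℝ)
    (W U : ℕ → Ω → ℝ) (x c : ℝ) (C : ℝ → Ω → ℝ) : Prop where
  adapted : ∀ t, 0 ≤ t → Measurable[surplusFiltration μ x p W U t] (C t)
  right_continuous : ∀ ω t, 0 ≤ t → ContinuousWithinAt (fun s => C s ω) (Set.Ici t) t
  left_limits : ∀ ω t, 0 < t → ∃ l, Tendsto (fun s => C s ω) (𝓝[<] t) (𝓝 l)
  monotone : ∀ ω, MonotoneOn (fun s => C s ω) (Set.Ici 0)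
  mem_Icc : ∀ ω t, 0 ≤ t → C t ω ∈ Set.Icc c cbar

/-- The controlled surplus `X_t^C = X_t - ∫_0^t C_s ds`. -/
def controlledSurplus {Ω : Type*} (x p : ℝ) (W U : ℕ → Ω → ℝ) (C : ℝ → Ω → ℝ) (t : ℝ) (ω : Ω) :
    ℝ :=
  surplus x p W U t ω - ∫ s in (0 : ℝ)..t, C s ω

/-- The ruin time `inf {t ≥ 0 : X_t^C < 0}`, equal to `∞` if ruin never occurs. -/
def ruinTime {Ω : Type*} (x p : ℝ) (W U : ℕ → Ω → ℝ) (C : ℝ → Ω → ℝ) (ω : Ω) : EReal :=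
  sInf ((fun t : ℝ => (t : EReal)) '' {t : ℝ | 0 ≤ t ∧ controlledSurplus x p W U C t ω < 0})

/-- The value `J(x; C) = E[∫_0^τ e^{-qs} C_s ds]` of the strategy `C`, where `τ` is the ruin time;
the integrand is nonnegative, so that this is an integral with values in `[0, ∞]`. -/
def strategyValue {Ω : Type*} [MeasurableSpace Ω] (μ : Measure Ω) (p q : ℝ) (W U : ℕ → Ω → ℝ)
    (x : ℝ) (C : ℝ → Ω → ℝ) : ENNReal :=
  ∫⁻ ω, (∫⁻ s in {s : ℝ | 0 ≤ s ∧ (s : EReal) < ruinTime x p W U C ω},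
    ENNReal.ofReal (Real.exp (-q * s) * C s ω)) ∂μ

/-- The supremum of the values of all admissible strategies, as an element of `[0, ∞]`. -/
def optimalValueENNReal {Ω : Type*} [MeasurableSpace Ω] (μ : Measure Ω) (p q cbar : ℝ)
    (W U : ℕ → Ω → ℝ) (x c : ℝ) : ENNReal :=
  ⨆ C ∈ {C : ℝ → Ω → ℝ | IsAdmissible μ p cbar W U x c C}, strategyValue μ p q W U x C

/-- The optimal value function `V(x,c)`, the supremum of `J(x; C)` over `C ∈ Π_{x,c,cbar}`. It is
real-valued, because the supremum is finite: see `optimalValueENNReal_le`. -/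
def optimalValue {Ω : Type*} [MeasurableSpace Ω] (μ : Measure Ω) (p q cbar : ℝ)
    (W U : ℕ → Ω → ℝ) (x c : ℝ) : ℝ :=
  (optimalValueENNReal μ p q cbar W U x c).toReal

/-- The optimal value is at most `cbar / q`; in particular it is finite. -/
theorem optimalValueENNReal_le {Ω : Type*} [MeasurableSpace Ω] (μ : Measure Ω)
    [IsProbabilityMeasure μ] (p q cbar : ℝ) (hq : 0 < q) (hcbar : 0 ≤ cbar) (W U : ℕ → Ω → ℝ)
    (x c : ℝ) : optimalValueENNReal μ p q cbar W U x c ≤ ENNReal.ofReal (cbar / q) := by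
  refine iSup₂_le fun C hC => ?_
  have hC' : IsAdmissible μ p cbar W U x c C := hC
  have key : ∀ ω, (∫⁻ s in {s : ℝ | 0 ≤ s ∧ (s : EReal) < ruinTime x p W U C ω},
      ENNReal.ofReal (Real.exp (-q * s) * C s ω)) ≤ ENNReal.ofReal (cbar / q) := by
    intro ω
    calc _ ≤ ∫⁻ s in {s : ℝ | 0 ≤ s ∧ (s : EReal) < ruinTime x p W U C ω},
          ENNReal.ofReal (Real.exp (-q * s) * cbar) := by
          refine setLIntegral_mono (by fun_prop) fun s hs => ?_
          exact ENNReal.ofReal_le_ofReal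
            (mul_le_mul_of_nonneg_left (hC'.mem_Icc ω s hs.1).2 (Real.exp_pos _).le)
      _ ≤ ∫⁻ s in Set.Ici (0 : ℝ), ENNReal.ofReal (Real.exp (-q * s) * cbar) :=
          lintegral_mono_set fun s hs => hs.1
      _ = ∫⁻ s in Set.Ioi (0 : ℝ), ENNReal.ofReal (Real.exp (-q * s) * cbar) :=
          setLIntegral_congr Ioi_ae_eq_Ici.symm
      _ = ENNReal.ofReal (∫ s in Set.Ioi (0 : ℝ), Real.exp (-q * s) * cbar) := by
          rw [ofReal_integral_eq_lintegral_ofReal]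
          · exact (integrableOn_exp_mul_Ioi (neg_lt_zero.mpr hq) 0).mul_const cbar
          · exact ae_of_all _ fun s => mul_nonneg (Real.exp_pos _).le hcbar
      _ = ENNReal.ofReal (cbar / q) := by
          rw [integral_mul_const, integral_exp_mul_Ioi (neg_lt_zero.mpr hq)]
          congr 1
          simp
          field_simp
  calc strategyValue μ p q W U x C ≤ ∫⁻ _, ENNReal.ofReal (cbar / q) ∂μ := lintegral_mono key
    _ = ENNReal.ofReal (cbar / q) := by simp

end

end Ratcheting

/-! The upper bound comes from a pathwise comparison. Given a strategy `C` for `(x₂, c₁)`, use `D =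
max C c₂` from `x₁`. Since `D ≥ C`, dividends are lost only at times when `D` is ruined and `C` is
not.

Put `k = c₁ - p > 0`, `d = c₂ - c₁`, and let `a` be the ruin time of `D`. Claims are nonnegative, so
both surpluses decrease at rate at least `k`; hence `a ≤ x₁ / k`. At time `a` the `C`-surplus
exceeds the `D`-surplus by at most `x₂ - x₁ + d a`, and this excess is used up within time `(x₂ - x₁
+ d a) / k`. That bounds the extra lifetime (`exists_diff_subset_Icc`), and each unit of it costs at
most `cbar` (`setLIntegral_dividends_le`). Taking expectations and then the supremum over `C` gives
`optimalValueENNReal_le_add`.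

The lower bound is monotonicity: more capital and a weaker constraint on the rate can only help. -/

namespace Ratcheting

/-! ### Almost sure properties of claims and arrival times -/

section Probability

variable {Ω : Type*} [MeasurableSpace Ω] {μ : Measure Ω} {β : ℝ} {ν : Measure ℝ}
  {W U : ℕ → Ω → ℝ}

theorem expMeasure_Iic {β : ℝ} (hβ : 0 < β) {x : ℝ} (hx : 0 ≤ x) :
    expMeasure β (Iic x) = ENNReal.ofReal (1 - Real.exp (-(β * x))) := by
  have := isProbabilityMeasure_expMeasure hβ
  rw [← ofReal_cdf, cdf_expMeasure_eq hβ, if_pos hx]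

theorem expMeasure_Ioi_one_ne_zero {β : ℝ} (hβ : 0 < β) : expMeasure β (Ioi 1) ≠ 0 := by
  have := isProbabilityMeasure_expMeasure hβ
  rw [← compl_Iic, Ne, prob_compl_eq_zero_iff measurableSet_Iic,
    expMeasure_Iic hβ zero_le_one]
  refine ne_of_lt (ENNReal.ofReal_lt_one.2 ?_)
  linarith [Real.exp_pos (-(β * 1))]

namespace IsCramerLundberg

theorem ae_claim_nonneg (h : IsCramerLundberg μ β ν W U) (hν : ν (Iio 0) = 0) :
    ∀ᵐ ω ∂μ, ∀ n, 0 ≤ U n ω := by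
  refine ae_all_iff.2 fun n => ?_
  rw [← h.map_claim n, Measure.map_apply (h.measurable_claim n) measurableSet_Iio] at hν
  rw [ae_iff]
  simpa [preimage] using hν

theorem ae_interarrival_nonneg (h : IsCramerLundberg μ β ν W U) (hβ : 0 < β) :
    ∀ᵐ ω ∂μ, ∀ n, 0 ≤ W n ω := by
  refine ae_all_iff.2 fun n => ?_
  have h0 : μ (W n ⁻¹' Iic 0) = 0 := by
    rw [← Measure.map_apply (h.measurable_interarrival n) measurableSet_Iic,
      h.map_interarrival n, expMeasure_Iic hβ le_rfl]
    simp
  rw [ae_iff]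
  exact measure_mono_null (fun ω hω => (not_le.1 hω).le) h0

/-- By the second Borel-Cantelli lemma, infinitely many interarrival times exceed `1`. -/
theorem ae_frequently_one_lt_interarrival [IsProbabilityMeasure μ]
    (h : IsCramerLundberg μ β ν W U) (hβ : 0 < β) :
    ∀ᵐ ω ∂μ, ∃ᶠ n in atTop, 1 < W n ω := by
  have hm : ∀ n, MeasurableSet (W n ⁻¹' Ioi 1) := fun n =>
    h.measurable_interarrival n measurableSet_Ioi
  have hW : iIndepFun W μ := h.indep.precomp (g := Sum.inl) Sum.inl_injective
  have hind : iIndepSet (fun n => W n ⁻¹' Ioi 1) μ := by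
    rw [iIndepSet_iff_meas_biInter hm]
    exact fun s => hW.measure_inter_preimage_eq_mul _ (fun _ _ => measurableSet_Ioi)
  have hsum : ∑' n, μ (W n ⁻¹' Ioi 1) = ⊤ := by
    have : ∀ n, μ (W n ⁻¹' Ioi 1) = expMeasure β (Ioi 1) := fun n => by
      rw [← h.map_interarrival n,
        Measure.map_apply (h.measurable_interarrival n) measurableSet_Ioi]
    simp_rw [this]
    exact ENNReal.tsum_const_eq_top_of_ne_zero (expMeasure_Ioi_one_ne_zero hβ)
  have hone := measure_limsup_eq_one hm hind hsum
  have hmem : ∀ᵐ ω ∂μ, ω ∈ limsup (fun n => W n ⁻¹' Ioi 1) atTop :=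
    (prob_compl_eq_zero_iff (MeasurableSet.measurableSet_limsup hm)).2 hone
  filter_upwards [hmem] with ω hω
  exact mem_limsup_iff_frequently_mem.1 hω

/-- Almost surely only finitely many claims arrive in bounded time. -/
theorem ae_finite_arrivals [IsProbabilityMeasure μ] (h : IsCramerLundberg μ β ν W U)
    (hβ : 0 < β) : ∀ᵐ ω ∂μ, ∀ t, {n : ℕ | arrivalTime W n ω ≤ t}.Finite := by
  filter_upwards [h.ae_interarrival_nonneg hβ, h.ae_frequently_one_lt_interarrival hβ]
    with ω h0 h1 t
  have hns : ¬ Summable fun n => W n ω := fun hs =>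
    h1 ((hs.tendsto_atTop_zero.eventually_lt_const one_pos).mono fun n hn => hn.not_gt)
  have ht := (not_summable_iff_tendsto_nat_atTop_of_nonneg h0).1 hns
  have hev := (ht.comp (tendsto_add_atTop_nat 1)).eventually_gt_atTop t
  rw [← Nat.cofinite_eq_atTop] at hev
  simpa [arrivalTime] using eventually_cofinite.1 hev

end IsCramerLundberg

end Probability

/-! ### Pathwise comparison of surpluses and ruin times -/

section Path

variable {Ω : Type*} {W U : ℕ → Ω → ℝ} {ω : Ω}

theorem surplus_le (hU : ∀ n, 0 ≤ U n ω)
    (hfin : ∀ t, {n : ℕ | arrivalTime W n ω ≤ t}.Finite) (x p : ℝ) {s t : ℝ} (hst : s ≤ t) :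
    surplus x p W U t ω ≤ surplus x p W U s ω + p * (t - s) := by
  have hcount : claimCount W s ω ≤ claimCount W t ω :=
    ncard_le_ncard (fun n hn => le_trans hn hst) (hfin t)
  have hsum : ∑ i ∈ Finset.range (claimCount W s ω), U i ω ≤
      ∑ i ∈ Finset.range (claimCount W t ω), U i ω :=
    Finset.sum_le_sum_of_subset_of_nonneg (Finset.range_mono hcount) fun i _ _ => hU i
  simp only [surplus]
  linarith

/-- Only an inequality, because on an arbitrary path claims may already have arrived at time `0`. -/
theorem surplus_zero_le (hU : ∀ n, 0 ≤ U n ω) (x p : ℝ) : surplus x p W U 0 ω ≤ x := by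
  have := Finset.sum_nonneg fun i (_ : i ∈ Finset.range (claimCount W 0 ω)) => hU i
  simp only [surplus]
  linarith

theorem surplus_eq_add (x y p t : ℝ) (ω : Ω) :
    surplus y p W U t ω = surplus x p W U t ω + (y - x) := by
  simp only [surplus]
  ring

theorem MonotoneOn.intervalIntegrable_of_nonneg {f : ℝ → ℝ} (hf : MonotoneOn f (Ici 0)) {s t : ℝ}
    (hs : 0 ≤ s) (ht : 0 ≤ t) : IntervalIntegrable f volume s t :=
  MonotoneOn.intervalIntegrable (hf.mono fun _ hr => (le_min hs ht).trans hr.1)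

theorem controlledSurplus_le (hU : ∀ n, 0 ≤ U n ω)
    (hfin : ∀ t, {n : ℕ | arrivalTime W n ω ≤ t}.Finite) (x p : ℝ) {c : ℝ} {C : ℝ → Ω → ℝ}
    (hmono : MonotoneOn (fun s => C s ω) (Ici 0)) (hc : ∀ t, 0 ≤ t → c ≤ C t ω)
    {s t : ℝ} (hs : 0 ≤ s) (hst : s ≤ t) :
    controlledSurplus x p W U C t ω ≤ controlledSurplus x p W U C s ω - (c - p) * (t - s) := by
  have hi : ∀ {a b : ℝ}, 0 ≤ a → 0 ≤ b → IntervalIntegrable (fun r => C r ω) volume a b :=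
    fun ha hb => MonotoneOn.intervalIntegrable_of_nonneg hmono ha hb
  have hsplit := intervalIntegral.integral_add_adjacent_intervals (hi le_rfl hs)
    (hi hs (hs.trans hst))
  have hge : c * (t - s) ≤ ∫ r in s..t, C r ω := by
    have := intervalIntegral.integral_mono_on hst intervalIntegrable_const
      (hi hs (hs.trans hst)) (fun r hr => hc r (hs.trans hr.1))
    simpa [mul_comm] using this
  have := surplus_le hU hfin x p hst
  simp only [controlledSurplus]
  linarith

theorem controlledSurplus_le_of_nonneg (hU : ∀ n, 0 ≤ U n ω)
    (hfin : ∀ t, {n : ℕ | arrivalTime W n ω ≤ t}.Finite) (x p : ℝ) {c : ℝ} {C : ℝ → Ω → ℝ}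
    (hmono : MonotoneOn (fun s => C s ω) (Ici 0)) (hc : ∀ t, 0 ≤ t → c ≤ C t ω)
    {t : ℝ} (ht : 0 ≤ t) :
    controlledSurplus x p W U C t ω ≤ x - (c - p) * t := by
  have h1 := controlledSurplus_le hU hfin x p hmono hc le_rfl ht
  have h2 : controlledSurplus x p W U C 0 ω ≤ x := by
    simpa [controlledSurplus] using surplus_zero_le hU x p
  linarith

/-- Raising the dividend rate by at most `d` and lowering the initial surplus from `x₂` to `x₁`
lowers the surplus at time `t` by at most `x₂ - x₁ + d t`. -/
theorem controlledSurplus_le_add (x₁ x₂ p : ℝ) {d : ℝ} {C D : ℝ → Ω → ℝ}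
    (hC : MonotoneOn (fun s => C s ω) (Ici 0)) (hD : MonotoneOn (fun s => D s ω) (Ici 0))
    (hd : ∀ t, 0 ≤ t → D t ω ≤ C t ω + d) {t : ℝ} (ht : 0 ≤ t) :
    controlledSurplus x₂ p W U C t ω ≤
      controlledSurplus x₁ p W U D t ω + (x₂ - x₁) + d * t := by
  have hCi := MonotoneOn.intervalIntegrable_of_nonneg hC le_rfl ht
  have hDi := MonotoneOn.intervalIntegrable_of_nonneg hD le_rfl ht
  have hle := intervalIntegral.integral_mono_on ht hDi (hCi.add intervalIntegrable_const)
    (fun r hr => hd r hr.1)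
  rw [intervalIntegral.integral_add hCi intervalIntegrable_const] at hle
  simp only [intervalIntegral.integral_const, smul_eq_mul, sub_zero] at hle
  simp only [controlledSurplus, surplus_eq_add x₁ x₂]
  linarith

/-- The times before ruin of `(x₂, C)` that are not before ruin of `(x₁, D)` form a set contained
in a short interval. -/
theorem exists_diff_subset_Icc (hU : ∀ n, 0 ≤ U n ω)
    (hfin : ∀ t, {n : ℕ | arrivalTime W n ω ≤ t}.Finite) {x₁ x₂ p c d : ℝ} {C D : ℝ → Ω → ℝ}
    (hx₁ : 0 ≤ x₁) (hx : x₁ ≤ x₂) (hcp : p < c) (hd0 : 0 ≤ d)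
    (hC : MonotoneOn (fun s => C s ω) (Ici 0)) (hD : MonotoneOn (fun s => D s ω) (Ici 0))
    (hcC : ∀ t, 0 ≤ t → c ≤ C t ω) (hcD : ∀ t, 0 ≤ t → c ≤ D t ω)
    (hd : ∀ t, 0 ≤ t → D t ω ≤ C t ω + d) :
    ∃ a, 0 ≤ a ∧ {s : ℝ | 0 ≤ s ∧ (s : EReal) < ruinTime x₂ p W U C ω} \
        {s : ℝ | 0 ≤ s ∧ (s : EReal) < ruinTime x₁ p W U D ω} ⊆
      Icc a (a + ((x₂ - x₁) / (c - p) + x₁ / (c - p) ^ 2 * d)) := by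
  have hk : 0 < c - p := sub_pos.2 hcp
  set A : Set ℝ := {t : ℝ | 0 ≤ t ∧ controlledSurplus x₁ p W U D t ω < 0} with hA
  -- Ruin under `D` is certain by time `x₁ / (c - p)`. Thus `A` is nonempty and its real infimum is
  -- the genuine ruin time, not the default value `0`.
  have hmemA : ∀ t, x₁ / (c - p) < t → t ∈ A := fun t ht => by
    have ht0 : 0 ≤ t := (div_nonneg hx₁ hk.le).trans ht.le
    refine ⟨ht0, (controlledSurplus_le_of_nonneg hU hfin x₁ p hD hcD ht0).trans_lt ?_⟩
    rw [div_lt_iff₀ hk] at ht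
    linarith
  have hbdd : BddBelow A := ⟨0, fun t ht => ht.1⟩
  have hne : A.Nonempty := ⟨_, hmemA _ (lt_add_one _)⟩
  have ha0 : 0 ≤ sInf A := le_csInf hne fun t ht => ht.1
  have hale : sInf A ≤ x₁ / (c - p) :=
    le_of_forall_gt_imp_ge_of_dense fun t ht => csInf_le hbdd (hmemA t ht)
  refine ⟨sInf A, ha0, ?_⟩
  rintro s ⟨⟨hs0, hs2⟩, hs1⟩
  have hnonneg : 0 ≤ controlledSurplus x₂ p W U C s ω := by
    by_contra! hneg
    exact hs2.not_ge (sInf_le ⟨s, ⟨hs0, hneg⟩, rfl⟩)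
  constructor
  · by_contra! hlt
    refine hs1 ⟨hs0, (EReal.coe_lt_coe_iff.2 hlt).trans_le (le_sInf ?_)⟩
    rintro _ ⟨t, ht, rfl⟩
    exact EReal.coe_le_coe_iff.2 (csInf_le hbdd ht)
  · have hm : 0 < c - p + d := by linarith
    -- The infimum need not belong to `A`, so the estimate is proved at every `t ∈ A` in a form
    -- linear in `t`. For `t ≤ s` it combines the excess at `t` with the decrease from `t` to `s`;
    -- for `s ≤ t` it is immediate.
    have hle : ((c - p) * s - (x₂ - x₁)) / (c - p + d) ≤ sInf A := by
      refine le_csInf hne fun t ht => ?_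
      rw [div_le_iff₀ hm]
      have hdt : 0 ≤ d * t := mul_nonneg hd0 ht.1
      rcases le_total t s with hts | hst
      · have h1 := controlledSurplus_le hU hfin x₂ p hC hcC ht.1 hts
        have h2 := controlledSurplus_le_add (W := W) (U := U) x₁ x₂ p hC hD hd ht.1
        linarith [ht.2]
      · have := mul_le_mul_of_nonneg_left hst hk.le
        linarith
    rw [div_le_iff₀ hm] at hle
    have hda : d * sInf A ≤ d * (x₁ / (c - p)) := mul_le_mul_of_nonneg_left hale hd0
    refine le_of_mul_le_mul_left ?_ hk
    have hexp : (c - p) * (sInf A + ((x₂ - x₁) / (c - p) + x₁ / (c - p) ^ 2 * d)) =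
        (c - p) * sInf A + (x₂ - x₁) + d * (x₁ / (c - p)) := by
      field_simp
      ring
    linarith

theorem ruinTime_mono {x y p : ℝ} (hxy : x ≤ y) (C : ℝ → Ω → ℝ) (ω : Ω) :
    ruinTime x p W U C ω ≤ ruinTime y p W U C ω := by
  refine sInf_le_sInf (image_mono ?_)
  rintro t ⟨ht, hneg⟩
  refine ⟨ht, lt_of_le_of_lt ?_ hneg⟩
  simp only [controlledSurplus, surplus_eq_add x y]
  linarith

end Path

/-! ### Admissible strategies and comparison of values -/

section Value

variable {Ω : Type*} [MeasurableSpace Ω] {μ : Measure Ω} {W U : ℕ → Ω → ℝ}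
  {p q cbar : ℝ}

/-- The two surplus processes differ by a constant, so they generate the same events; by symmetry
one inclusion is enough. -/
theorem surplusFiltration_le (x y p : ℝ) (t : ℝ) :
    surplusFiltration μ x p W U t ≤ surplusFiltration μ y p W U t := by
  have h : (⨆ s ∈ Icc (0 : ℝ) t, MeasurableSpace.comap (surplus x p W U s) inferInstance) ≤
      ⨆ s ∈ Icc (0 : ℝ) t, MeasurableSpace.comap (surplus y p W U s) inferInstance := by
    refine iSup₂_mono fun s _ => ?_
    rintro _ ⟨B, hB, rfl⟩
    refine ⟨(fun r => r + (x - y)) ⁻¹' B, measurable_id.add_const _ hB, ?_⟩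
    ext ω
    simp [surplus_eq_add y x]
  refine inf_le_inf_right _ ?_
  rintro A ⟨B, hB, hAB⟩
  exact ⟨B, h B hB, hAB⟩

namespace IsAdmissible

variable {x y b c : ℝ} {C : ℝ → Ω → ℝ}

/-- Admissibility does not depend on the initial surplus. -/
theorem change_surplus (h : IsAdmissible μ p cbar W U x c C) (y : ℝ) :
    IsAdmissible μ p cbar W U y c C where
  adapted t ht := (h.adapted t ht).mono (surplusFiltration_le x y p t) le_rfl
  right_continuous := h.right_continuous
  left_limits := h.left_limits
  monotone := h.monotone
  mem_Icc := h.mem_Icc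

theorem mono_left (h : IsAdmissible μ p cbar W U x c C) (hbc : b ≤ c) :
    IsAdmissible μ p cbar W U x b C where
  adapted := h.adapted
  right_continuous := h.right_continuous
  left_limits := h.left_limits
  monotone := h.monotone
  mem_Icc ω t ht := Icc_subset_Icc_left hbc (h.mem_Icc ω t ht)

theorem max_const (h : IsAdmissible μ p cbar W U x b C) (hc : c ≤ cbar) :
    IsAdmissible μ p cbar W U x c (fun t ω => max (C t ω) c) where
  adapted t ht := (h.adapted t ht).max measurable_const
  right_continuous ω t ht := (h.right_continuous ω t ht).max continuousWithinAt_const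
  left_limits ω t ht := by
    obtain ⟨l, hl⟩ := h.left_limits ω t ht
    exact ⟨max l c, hl.max tendsto_const_nhds⟩
  monotone ω _ hs _ ht hst := max_le_max_right c (h.monotone ω hs ht hst)
  mem_Icc ω t ht := ⟨le_max_right _ _, max_le (h.mem_Icc ω t ht).2 hc⟩

end IsAdmissible

theorem strategyValue_mono {x y : ℝ} (hxy : x ≤ y) (C : ℝ → Ω → ℝ) :
    strategyValue μ p q W U x C ≤ strategyValue μ p q W U y C :=
  lintegral_mono fun ω => lintegral_mono_set fun _ hs =>
    ⟨hs.1, hs.2.trans_le (ruinTime_mono hxy C ω)⟩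

/-- Every strategy for `(x₁, c₂)` is also admissible for `(x₂, c₁)`, where ruin comes no earlier. -/
theorem optimalValueENNReal_mono {x₁ x₂ c₁ c₂ : ℝ} (hx : x₁ ≤ x₂) (hc : c₁ ≤ c₂) :
    optimalValueENNReal μ p q cbar W U x₁ c₂ ≤ optimalValueENNReal μ p q cbar W U x₂ c₁ :=
  iSup₂_le fun C hC => (strategyValue_mono hx C).trans <|
    le_iSup₂_of_le C ((IsAdmissible.change_surplus hC x₂).mono_left hc) le_rfl

/-- If the dividend rate `c` is bounded by `d` and by `cbar`, the discounted dividends over `S` exceed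
those of `d` over `T` at most by the undiscounted dividends at rate `cbar` during `S \ T`. -/
theorem setLIntegral_dividends_le (hq : 0 ≤ q) {c d : ℝ → ℝ} {S T : Set ℝ} {a l : ℝ}
    (ha : 0 ≤ a) (hcbar : 0 ≤ cbar) (hTm : MeasurableSet T) (hT : T ⊆ Ici 0)
    (hST : S \ T ⊆ Icc a (a + l)) (hcd : ∀ t, 0 ≤ t → c t ≤ d t)
    (hcle : ∀ t, 0 ≤ t → c t ≤ cbar) :
    ∫⁻ s in S, ENNReal.ofReal (Real.exp (-q * s) * c s) ≤
      (∫⁻ s in T, ENNReal.ofReal (Real.exp (-q * s) * d s)) + ENNReal.ofReal (cbar * l) := by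
  have hsub : S ⊆ T ∪ Icc a (a + l) := fun s hs => by
    by_cases h : s ∈ T
    · exact Or.inl h
    · exact Or.inr (hST ⟨hs, h⟩)
  refine (lintegral_mono_set hsub).trans ((lintegral_union_le _ _ _).trans (add_le_add ?_ ?_))
  · exact setLIntegral_mono' hTm fun s hs => ENNReal.ofReal_le_ofReal
      (mul_le_mul_of_nonneg_left (hcd s (hT hs)) (Real.exp_pos _).le)
  · calc ∫⁻ s in Icc a (a + l), ENNReal.ofReal (Real.exp (-q * s) * c s)
        ≤ ∫⁻ _ in Icc a (a + l), ENNReal.ofReal cbar := by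
          refine setLIntegral_mono measurable_const fun s hs => ENNReal.ofReal_le_ofReal ?_
          have hs0 : 0 ≤ s := ha.trans hs.1
          have hexp : Real.exp (-q * s) ≤ 1 := by
            rw [Real.exp_le_one_iff]
            nlinarith
          calc Real.exp (-q * s) * c s ≤ Real.exp (-q * s) * cbar :=
                mul_le_mul_of_nonneg_left (hcle s hs0) (Real.exp_pos _).le
            _ ≤ cbar := mul_le_of_le_one_left hcbar hexp
      _ = ENNReal.ofReal (cbar * l) := by
          rw [setLIntegral_const, Real.volume_Icc, add_sub_cancel_left, ENNReal.ofReal_mul hcbar]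

theorem strategyValue_le_max_const_add [IsProbabilityMeasure μ] (hq : 0 ≤ q) (hcbar : 0 ≤ cbar)
    (hU : ∀ᵐ ω ∂μ, ∀ n, 0 ≤ U n ω)
    (hfin : ∀ᵐ ω ∂μ, ∀ t, {n : ℕ | arrivalTime W n ω ≤ t}.Finite) {x₁ x₂ c₁ c₂ : ℝ}
    (hx₁ : 0 ≤ x₁) (hx : x₁ ≤ x₂) (hcp : p < c₁) (hc : c₁ ≤ c₂) (hc₂ : c₂ ≤ cbar)
    {C : ℝ → Ω → ℝ} (hC : IsAdmissible μ p cbar W U x₂ c₁ C) :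
    strategyValue μ p q W U x₂ C ≤
      strategyValue μ p q W U x₁ (fun t ω => max (C t ω) c₂) +
        ENNReal.ofReal (cbar * ((x₂ - x₁) / (c₁ - p) + x₁ / (c₁ - p) ^ 2 * (c₂ - c₁))) := by
  have hD := hC.max_const hc₂
  have key : ∀ᵐ ω ∂μ,
      ∫⁻ s in {s : ℝ | 0 ≤ s ∧ (s : EReal) < ruinTime x₂ p W U C ω},
        ENNReal.ofReal (Real.exp (-q * s) * C s ω) ≤
      (∫⁻ s in {s : ℝ | 0 ≤ s ∧
          (s : EReal) < ruinTime x₁ p W U (fun t ω => max (C t ω) c₂) ω},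
        ENNReal.ofReal (Real.exp (-q * s) * max (C s ω) c₂)) +
      ENNReal.ofReal (cbar * ((x₂ - x₁) / (c₁ - p) + x₁ / (c₁ - p) ^ 2 * (c₂ - c₁))) := by
    filter_upwards [hU, hfin] with ω hUω hfinω
    obtain ⟨a, ha, hsub⟩ := exists_diff_subset_Icc hUω hfinω (x₂ := x₂) (C := C)
      (D := fun t ω => max (C t ω) c₂) hx₁ hx hcp
      (sub_nonneg.2 hc) (hC.monotone ω) (hD.monotone ω) (fun t ht => (hC.mem_Icc ω t ht).1)
      (fun t ht => hc.trans (hD.mem_Icc ω t ht).1)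
      (fun t ht => max_le (le_add_of_nonneg_right (sub_nonneg.2 hc))
        (by linarith [(hC.mem_Icc ω t ht).1]))
    exact setLIntegral_dividends_le hq ha hcbar
      (measurableSet_Ici.inter (measurable_coe_real_ereal measurableSet_Iio)) (fun s hs => hs.1)
      hsub (fun t _ => le_max_left _ _) (fun t ht => (hC.mem_Icc ω t ht).2)
  refine (lintegral_mono_ae key).trans_eq ?_
  -- Splitting off the constant requires measurability of that constant only, not of the random
  -- discounted dividends.
  rw [lintegral_add_right _ measurable_const, lintegral_const, measure_univ, mul_one]
  rfl

theorem optimalValueENNReal_le_add [IsProbabilityMeasure μ] (hq : 0 ≤ q) (hcbar : 0 ≤ cbar)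
    (hU : ∀ᵐ ω ∂μ, ∀ n, 0 ≤ U n ω)
    (hfin : ∀ᵐ ω ∂μ, ∀ t, {n : ℕ | arrivalTime W n ω ≤ t}.Finite) {x₁ x₂ c₁ c₂ : ℝ}
    (hx₁ : 0 ≤ x₁) (hx : x₁ ≤ x₂) (hcp : p < c₁) (hc : c₁ ≤ c₂) (hc₂ : c₂ ≤ cbar) :
    optimalValueENNReal μ p q cbar W U x₂ c₁ ≤ optimalValueENNReal μ p q cbar W U x₁ c₂ +
      ENNReal.ofReal (cbar * ((x₂ - x₁) / (c₁ - p) + x₁ / (c₁ - p) ^ 2 * (c₂ - c₁))) :=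
  iSup₂_le fun C hC =>
    (strategyValue_le_max_const_add hq hcbar hU hfin hx₁ hx hcp hc hc₂ hC).trans <| by
      gcongr
      exact le_iSup₂_of_le (fun t ω => max (C t ω) c₂)
        ((IsAdmissible.max_const hC hc₂).change_surplus x₁) le_rfl

end Value

end Ratcheting

theorem mainTheorem8 (p β q cbar : ℝ) (ν : Measure ℝ) [IsProbabilityMeasure ν]
    (hβ : 0 < β) (hq : 0 < q)
    -- claim sizes are nonnegative and have a finite mean, with safety loading `p > β E[U]`
    (hν_nonneg : ν (Set.Iio 0) = 0) (hν_int : Integrable (fun u : ℝ => u) ν)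
    (hp : β * ∫ u, u ∂ν < p)
    -- the claim size distribution function is globally Lipschitz
    (hF : ∃ K : ℝ, 0 < K ∧ ∀ a b : ℝ, a < b → cdf ν b - cdf ν a ≤ K * (b - a))
    (hcbar : p < cbar) :
    ∃ K₂ K₃ : ℝ, 0 < K₂ ∧ 0 < K₃ ∧
      ∀ (Ω : Type*) [MeasurableSpace Ω] (μ : Measure Ω) [IsProbabilityMeasure μ]
        (W U : ℕ → Ω → ℝ), Ratcheting.IsCramerLundberg μ β ν W U →
        ∀ x₁ x₂ c₁ c₂ : ℝ, 0 ≤ x₁ → x₁ ≤ x₂ → p < c₁ → c₁ ≤ c₂ → c₂ ≤ cbar →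
          0 ≤ Ratcheting.optimalValue μ p q cbar W U x₂ c₁
              - Ratcheting.optimalValue μ p q cbar W U x₁ c₂ ∧
          Ratcheting.optimalValue μ p q cbar W U x₂ c₁
              - Ratcheting.optimalValue μ p q cbar W U x₁ c₂
            ≤ (K₂ + K₃ / (c₁ - p)) * (x₂ - x₁)
              + (K₂ + K₃ * x₂ / (c₁ - p) ^ 2) * (c₂ - c₁) := by
  -- A nonnegative mean claim and the safety loading give `p > 0`, hence `cbar > 0`.
  have hmean : 0 ≤ ∫ u, u ∂ν := integral_nonneg_of_ae <| by
    rw [EventuallyLE, ae_iff]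
    simpa [Iio_def] using hν_nonneg
  have hp0 : 0 < p := (mul_nonneg hβ.le hmean).trans_lt hp
  have hcbar0 : 0 < cbar := hp0.trans hcbar
  -- `K₃ = cbar` is the maximal dividend rate lost during the extra lifetime. The estimate already
  -- holds without `K₂`, so any positive value serves.
  refine ⟨1, cbar, one_pos, hcbar0, ?_⟩
  intro Ω _ μ _ W U hCL x₁ x₂ c₁ c₂ hx₁ hx hcp hc hc₂
  have hk : 0 < c₁ - p := sub_pos.2 hcp
  have hdx : 0 ≤ x₂ - x₁ := sub_nonneg.2 hx
  have hdc : 0 ≤ c₂ - c₁ := sub_nonneg.2 hc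
  have hfinite : ∀ x c, Ratcheting.optimalValueENNReal μ p q cbar W U x c ≠ ⊤ := fun x c =>
    ne_top_of_le_ne_top ENNReal.ofReal_ne_top
      (Ratcheting.optimalValueENNReal_le μ p q cbar hq hcbar0.le W U x c)
  constructor
  · exact sub_nonneg.2 (ENNReal.toReal_mono (hfinite _ _)
      (Ratcheting.optimalValueENNReal_mono hx hc))
  · have hle := ENNReal.toReal_mono (ENNReal.add_ne_top.2 ⟨hfinite _ _, ENNReal.ofReal_ne_top⟩)
      (Ratcheting.optimalValueENNReal_le_add hq.le hcbar0.le (hCL.ae_claim_nonneg hν_nonneg)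
        (hCL.ae_finite_arrivals hβ) hx₁ hx hcp hc hc₂)
    rw [ENNReal.toReal_add (hfinite _ _) ENNReal.ofReal_ne_top,
      ENNReal.toReal_ofReal (by positivity)] at hle
    have hx₂ : x₁ / (c₁ - p) ^ 2 ≤ x₂ / (c₁ - p) ^ 2 := by gcongr
    calc Ratcheting.optimalValue μ p q cbar W U x₂ c₁ - Ratcheting.optimalValue μ p q cbar W U x₁ c₂
        ≤ cbar * ((x₂ - x₁) / (c₁ - p) + x₁ / (c₁ - p) ^ 2 * (c₂ - c₁)) :=
          sub_le_iff_le_add'.2 hle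
      _ ≤ cbar * ((x₂ - x₁) / (c₁ - p) + x₂ / (c₁ - p) ^ 2 * (c₂ - c₁)) := by gcongr
      _ = cbar / (c₁ - p) * (x₂ - x₁) + cbar * x₂ / (c₁ - p) ^ 2 * (c₂ - c₁) := by ring
      _ ≤ (1 + cbar / (c₁ - p)) * (x₂ - x₁) + (1 + cbar * x₂ / (c₁ - p) ^ 2) * (c₂ - c₁) := by
          linarith
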